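/- Let $S$ be a compact smooth $k$-dimensional manifold without boundary, equipped with a fixed volume form $\mu$, and let $M$ be a smooth $n$-dimensional manifold without boundary; write $\pi:T^*M\to M$ for the cotangent bundle projection. Let $T^*\mathrm{Emb}(S,M)^\times$ be the set of 1-form densities $P\mu$, where $P:S\to T^*M$ is a smooth map such that its footpoint map $Q=\pi\circ P$ is a smooth embedding of $S$ into $M$ and $P(s)\neq 0$ for all $s\in S$. Define $$\mathbf J_L:T^*\mathrm{Emb}(S,M)^\times\to\mathfrak X(M)^*,\qquad \langle \mathbf J_L(P\mu),X\rangle=\int_S P\cdot(X\circ Q)\,\mu ,$$ where $\mathfrak X(M)$ is the space of smooth vector fields on $M$ and $S$ is oriented by $\mu$. The group $\mathrm{Diff}(S)$ of smooth diffeomorphisms of $S$ acts by the cotangent lift of $Q\mapsto Q\circ\psi$, i.e. by pullback of 1-form densities, $$(P\mu)\cdot\psi=|J(\psi)|\,(P\circ\psi)\,\mu ,\qquad \psi^*\mu=J(\psi)\mu .$$ Then this is a right action of $\mathrm{Diff}(S)$ on $T^*\mathrm{Emb}(S,M)^\times$, it preserves the level sets of $\mathbf J_L$, and it is transitive on each level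 set: if $P\mu$ and $P'\mu$ in $T^*\mathrm{Emb}(S,M)^\times$, with footpoint maps $Q$ and $Q'$, satisfy $\mathbf J_L(P\mu)=\mathbf J_L(P'\mu)$, then $Q(S)=Q'(S)$ and there is $\psi\in\mathrm{Diff}(S)$ with $Q'=Q\circ\psi$ and $P'\mu=(P\mu)\cdot\psi$. -/

import Mathlib

open Set MeasureTheory Manifold Bundle
open scoped ContDiff Manifold Bundle Topology

noncomputable section

namespace EPDiff

/-- The standard frame of the tangent space `T_sS`, which Mathlib models on `ℝᵏ` itself. -/
def stdFrame {k : ℕ} {S : Type*} [TopologicalSpace S] [ChartedSpace (EuclideanSpace ℝ (Fin k)) S]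
    (s : S) (i : Fin k) : TangentSpace (𝓡 k) s :=
  (EuclideanSpace.single i (1 : ℝ) : EuclideanSpace ℝ (Fin k))

/-- The frame of coordinate vector fields `∂/∂yᵢ` of the chart at `x`, at the point of `S` with
coordinates `y`. -/
def chartFrame {k : ℕ} {S : Type*} [TopologicalSpace S]
    [ChartedSpace (EuclideanSpace ℝ (Fin k)) S] (x : S) (y : EuclideanSpace ℝ (Fin k))
    (i : Fin k) : TangentSpace (𝓡 k) ((extChartAt (𝓡 k) x).symm y) :=
  mfderiv (𝓡 k) (𝓡 k) (extChartAt (𝓡 k) x).symm y (stdFrame y i)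

/-- A volume form on a `k`-dimensional manifold `S`: a smooth nowhere vanishing differential form
of degree `k`. Smoothness of a `k`-form `μ` means that in every chart the coefficient `a` in
`μ = a dy₁ ∧ ⋯ ∧ dy_k` is a smooth function of the coordinates. -/
structure VolumeForm (k : ℕ) (S : Type*) [TopologicalSpace S]
    [ChartedSpace (EuclideanSpace ℝ (Fin k)) S] where
  /-- the alternating form on each tangent space -/
  form : ∀ s : S, (TangentSpace (𝓡 k) s) [⋀^Fin k]→L[ℝ] ℝ
  smooth : ∀ x : S, ContDiffOn ℝ ∞
    (fun y => form ((extChartAt (𝓡 k) x).symm y) (chartFrame x y)) (extChartAt (𝓡 k) x).target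
  ne_zero : ∀ s : S, form s ≠ 0

namespace VolumeForm

variable {k : ℕ} {S : Type*} [TopologicalSpace S] [ChartedSpace (EuclideanSpace ℝ (Fin k)) S]

/-- The coefficient `a` of `μ = a dy₁ ∧ ⋯ ∧ dy_k` in the chart at `x`. -/
def coeff (μ : VolumeForm k S) (x : S) (y : EuclideanSpace ℝ (Fin k)) : ℝ :=
  μ.form ((extChartAt (𝓡 k) x).symm y) (chartFrame x y)

/-- The Jacobian function `J(ψ)` of a diffeomorphism `ψ` with respect to the volume form `μ`, that
is, `ψ^*μ = J(ψ) μ`; see `form_mfderiv`. -/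
def jacobian (μ : VolumeForm k S) (ψ : S ≃ₘ^∞⟮𝓡 k, 𝓡 k⟯ S) (s : S) : ℝ :=
  μ.form (ψ s) (fun i => mfderiv (𝓡 k) (𝓡 k) ψ s (stdFrame s i)) / μ.form s (stdFrame s)

/-- The defining property `ψ^*μ = J(ψ) μ` of the Jacobian function. -/
theorem form_mfderiv (μ : VolumeForm k S) (ψ : S ≃ₘ^∞⟮𝓡 k, 𝓡 k⟯ S) (s : S)
    (v : Fin k → TangentSpace (𝓡 k) s) :
    μ.form (ψ s) (fun i => mfderiv (𝓡 k) (𝓡 k) ψ s (v i)) = μ.jacobian ψ s * μ.form s v := by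
  let b : Module.Basis (Fin k) ℝ (TangentSpace (𝓡 k) s) :=
    (EuclideanSpace.basisFun (Fin k) ℝ).toBasis
  have hb : ⇑b = stdFrame s := by
    funext i
    exact EuclideanSpace.basisFun_apply (Fin k) ℝ i
  have key : ∀ f : (TangentSpace (𝓡 k) s) [⋀^Fin k]→ₗ[ℝ] ℝ, ∀ w, f w = f b * b.det w := by
    intro f w
    conv_lhs => rw [f.eq_smul_basis_det b]
    simp
  have h1 := key (μ.form s).toAlternatingMap
  have h2 := key ((μ.form (ψ s)).toAlternatingMap.compLinearMap
    (mfderiv (𝓡 k) (𝓡 k) ψ s).toLinearMap) v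
  have h0 : μ.form s (stdFrame s) ≠ 0 := by
    intro h
    refine μ.ne_zero s ?_
    ext w
    have := h1 w
    rw [hb] at this
    simpa [h] using this
  have h1v := h1 v
  rw [hb] at h1v h2
  change μ.form (ψ s) (fun i => mfderiv (𝓡 k) (𝓡 k) ψ s (v i)) =
    μ.form (ψ s) (fun i => mfderiv (𝓡 k) (𝓡 k) ψ s (stdFrame s i)) * b.det v at h2
  change μ.form s v = μ.form s (stdFrame s) * b.det v at h1v
  rw [h2, h1v, jacobian]
  field_simp

variable [IsManifold (𝓡 k) ∞ S] [CompactSpace S] [T2Space S]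

/-- A smooth partition of unity on `S` indexed by the points of `S`, with the `x`-th function
supported in the domain of the chart at `x`. -/
def partition (k : ℕ) (S : Type*) [TopologicalSpace S]
    [ChartedSpace (EuclideanSpace ℝ (Fin k)) S] [IsManifold (𝓡 k) ∞ S] [CompactSpace S]
    [T2Space S] : SmoothPartitionOfUnity S (𝓡 k) S univ :=
  (SmoothPartitionOfUnity.exists_isSubordinate_chartAt_source (𝓡 k) S).choose

theorem partition_subordinate (x : S) :
    tsupport (partition k S x) ⊆ (chartAt (EuclideanSpace ℝ (Fin k)) x).source :=
  (SmoothPartitionOfUnity.exists_isSubordinate_chartAt_source (𝓡 k) S).choose_spec x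

variable [MeasurableSpace S]

/-- The part of the measure of `μ` that is carried by the chart at `x`: the measure `ρₓ |a| dy` on
the chart's target, transported to `S`, where `ρ` is the partition of unity and `a` is the
coefficient of `μ`. -/
def chartMeasure (μ : VolumeForm k S) (x : S) : Measure S :=
  ((volume.restrict (extChartAt (𝓡 k) x).target).withDensity
    (fun y => ENNReal.ofReal
      (partition k S x ((extChartAt (𝓡 k) x).symm y) * |μ.coeff x y|))).map
    (extChartAt (𝓡 k) x).symm

/-- The measure on `S` defined by the volume form `μ`: `∫ f ∂μ.measure` is the integral `∫_S f μ`
over `S` with the orientation given by `μ`, glued from the charts by a partition of unity. -/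
def measure (μ : VolumeForm k S) : Measure S :=
  Measure.sum fun x : S => μ.chartMeasure x

/-- The measure of a volume form on a compact manifold is finite. -/
theorem isFiniteMeasure_measure (μ : VolumeForm k S) : IsFiniteMeasure μ.measure := by
  constructor
  rw [measure, Measure.sum_apply _ MeasurableSet.univ]
  have hfin : {x : S | (Function.support (partition k S x)).Nonempty}.Finite :=
    (partition k S).locallyFinite.finite_nonempty_of_compact
  have hle : ∀ x : S, μ.chartMeasure x univ ≤ ∫⁻ y in (extChartAt (𝓡 k) x).target,
      ENNReal.ofReal (partition k S x ((extChartAt (𝓡 k) x).symm y) * |μ.coeff x y|) := by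
    intro x
    by_cases hm : AEMeasurable (extChartAt (𝓡 k) x).symm
      ((volume.restrict (extChartAt (𝓡 k) x).target).withDensity
        (fun y => ENNReal.ofReal
          (partition k S x ((extChartAt (𝓡 k) x).symm y) * |μ.coeff x y|)))
    · rw [chartMeasure, Measure.map_apply_of_aemeasurable hm MeasurableSet.univ, preimage_univ,
        withDensity_apply _ MeasurableSet.univ, Measure.restrict_univ]
    · rw [chartMeasure, Measure.map_of_not_aemeasurable hm]
      simp
  have hzero : ∀ x ∉ hfin.toFinset, μ.chartMeasure x univ = 0 := by
    intro x hx
    have hx' : ∀ s, partition k S x s = 0 := by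
      intro s
      by_contra h
      exact hx (hfin.mem_toFinset.2 ⟨s, h⟩)
    refine le_antisymm ((hle x).trans ?_) bot_le
    simp [hx']
  rw [tsum_eq_sum hzero]
  refine ENNReal.sum_lt_top.2 fun x _ => (hle x).trans_lt ?_
  set φ := extChartAt (𝓡 k) x with hφ
  set K : Set (EuclideanSpace ℝ (Fin k)) := φ '' tsupport (partition k S x) with hK
  have hsub : tsupport (partition k S x) ⊆ φ.source := by
    rw [hφ, extChartAt_source]
    exact partition_subordinate x
  have hKc : IsCompact K :=
    (isClosed_tsupport _).isCompact.image_of_continuousOn ((continuousOn_extChartAt x).mono hsub)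
  have hKt : K ⊆ φ.target := by
    rintro _ ⟨s, hs, rfl⟩
    exact φ.map_source (hsub hs)
  have hcont : ContinuousOn (fun y => partition k S x (φ.symm y) * |μ.coeff x y|) φ.target := by
    refine ContinuousOn.mul ?_ (μ.smooth x).continuousOn.abs
    exact (partition k S x).2.continuous.comp_continuousOn (continuousOn_extChartAt_symm x)
  have hint : IntegrableOn (fun y => partition k S x (φ.symm y) * |μ.coeff x y|) K volume :=
    (hcont.mono hKt).integrableOn_compact hKc
  calc ∫⁻ y in φ.target, ENNReal.ofReal (partition k S x (φ.symm y) * |μ.coeff x y|)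
      ≤ ∫⁻ y in φ.target, K.indicator
          (fun y => ENNReal.ofReal (partition k S x (φ.symm y) * |μ.coeff x y|)) y := by
        refine setLIntegral_mono' (isOpen_extChartAt_target x).measurableSet fun y hy => ?_
        by_cases hyK : y ∈ K
        · rw [indicator_of_mem hyK]
        · have : partition k S x (φ.symm y) = 0 := by
            by_contra h
            exact hyK ⟨φ.symm y, subset_tsupport _ h, φ.right_inv hy⟩
          simp [this]
    _ ≤ ∫⁻ y, K.indicator
          (fun y => ENNReal.ofReal (partition k S x (φ.symm y) * |μ.coeff x y|)) y :=
        setLIntegral_le_lintegral _ _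
    _ = ∫⁻ y in K, ENNReal.ofReal (partition k S x (φ.symm y) * |μ.coeff x y|) :=
        lintegral_indicator hKc.measurableSet _
    _ < ⊤ := hint.lintegral_lt_top

end VolumeForm

/-- The cotangent bundle `T^*M`. -/
abbrev Cotangent (n : ℕ) (M : Type*) [TopologicalSpace M]
    [ChartedSpace (EuclideanSpace ℝ (Fin n)) M] [IsManifold (𝓡 n) ∞ M] :=
  TotalSpace (EuclideanSpace ℝ (Fin n) →L[ℝ] ℝ)
    (fun x : M => TangentSpace (𝓡 n) x →L[ℝ] Bundle.Trivial M ℝ x)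

/-- The space `𝔛(M)` of smooth vector fields on `M`. -/
abbrev VectorFields (n : ℕ) (M : Type*) [TopologicalSpace M]
    [ChartedSpace (EuclideanSpace ℝ (Fin n)) M] [IsManifold (𝓡 n) ∞ M] :=
  ContMDiffSection (𝓡 n) (EuclideanSpace ℝ (Fin n)) ∞ (fun x : M => TangentSpace (𝓡 n) x)

section

variable {k n : ℕ} {S : Type*} [TopologicalSpace S] [ChartedSpace (EuclideanSpace ℝ (Fin k)) S]
  {M : Type*} [TopologicalSpace M] [ChartedSpace (EuclideanSpace ℝ (Fin n)) M]
  [IsManifold (𝓡 n) ∞ M]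

/-- The footpoint map `Q = π ∘ P : S → M` of a map `P : S → T^*M`. -/
def footpoint (P : S → Cotangent n M) (s : S) : M := (P s).proj

variable (k n S M) in
/-- The space `T^*Emb(S,M)^×`. A 1-form density `Pμ`, for the fixed volume form `μ`, is given by
the smooth map `P : S → T^*M`; its footpoint map must be an embedding and `P` must be nonzero at
every point of `S`. -/
def CotEmbNonvanishing : Set (S → Cotangent n M) :=
  {P | ContMDiff (𝓡 k) ((𝓡 n).prod 𝓘(ℝ, EuclideanSpace ℝ (Fin n) →L[ℝ] ℝ)) ∞ P ∧
    IsSmoothEmbedding (𝓡 k) (𝓡 n) ∞ (footpoint P) ∧ ∀ s, (P s).snd ≠ 0}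

/-- The right action of a diffeomorphism `ψ` of `S`, the cotangent lift of `Q ↦ Q ∘ ψ`. The 1-form
density `Pμ` is sent to its pullback `(P ∘ ψ) ψ^*μ`, `μ` being pulled back as a density, so that
in terms of `P` it reads `P ↦ |J(ψ)| (P ∘ ψ)`. The absolute value is what makes
`⟨(Pμ)·ψ, V ∘ ψ⟩ = ⟨Pμ, V⟩` hold also where `ψ` reverses the orientation. -/
def rightAct (μ : VolumeForm k S) (P : S → Cotangent n M) (ψ : S ≃ₘ^∞⟮𝓡 k, 𝓡 k⟯ S) :
    S → Cotangent n M :=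
  fun s => ⟨(P (ψ s)).proj, |μ.jacobian ψ s| • (P (ψ s)).snd⟩

/-- The function `P · (X ∘ Q)` on `S`. -/
def pairing (P : S → Cotangent n M) (X : VectorFields n M) (s : S) : ℝ :=
  (P s).snd (X (P s).proj)

theorem continuous_pairing {P : S → Cotangent n M} (hP : P ∈ CotEmbNonvanishing k n S M)
    (X : VectorFields n M) : Continuous (pairing P X) := by
  have hQ : ContMDiff (𝓡 k) (𝓡 n) ∞ (footpoint P) := hP.2.1.contMDiff
  have hX : ContMDiff (𝓡 k) ((𝓡 n).prod 𝓘(ℝ, EuclideanSpace ℝ (Fin n))) ∞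
      (fun s => TotalSpace.mk' (EuclideanSpace ℝ (Fin n))
        (E := fun x : M => TangentSpace (𝓡 n) x) (footpoint P s) (X (footpoint P s))) :=
    X.contMDiff.comp hQ
  have h := ContMDiff.clm_bundle_apply (F₂ := ℝ) (E₂ := Bundle.Trivial M ℝ)
    (b := footpoint P) (ϕ := fun s => (P s).snd) hP.1 hX
  exact continuous_iff_continuousAt.2 fun s => (contMDiffAt_totalSpace.1 (h s)).2.continuousAt

variable [IsManifold (𝓡 k) ∞ S] [CompactSpace S] [T2Space S] [MeasurableSpace S] [BorelSpace S]

theorem integrable_pairing (μ : VolumeForm k S) {P : S → Cotangent n M}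
    (hP : P ∈ CotEmbNonvanishing k n S M) (X : VectorFields n M) :
    Integrable (pairing P X) μ.measure := by
  have := μ.isFiniteMeasure_measure
  exact (continuous_pairing hP X).integrable_of_hasCompactSupport
    (HasCompactSupport.of_compactSpace _)

/-- The left momentum map `J_L : T^*Emb(S,M)^× → 𝔛(M)^*`,
`⟨J_L(Pμ), X⟩ = ∫_S P · (X ∘ Q) μ`. -/
def momentumLeft (μ : VolumeForm k S) (P : CotEmbNonvanishing k n S M) :
    Module.Dual ℝ (VectorFields n M) where
  toFun X := ∫ s, pairing P.1 X s ∂μ.measure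
  map_add' X Y := by
    rw [← integral_add (integrable_pairing μ P.2 X) (integrable_pairing μ P.2 Y)]
    simp [pairing]
  map_smul' c X := by
    rw [RingHom.id_apply, smul_eq_mul, ← integral_const_mul]
    simp [pairing]

end

end EPDiff

end

/-! Invariance of `momentumLeft` is the change of variables formula `∫ |J(ψ)| (f ∘ ψ) μ = ∫ f μ`.
The action laws come from the cocycle identity `jacobian_trans`, and `rightAct` stays in the space
because `J(ψ)` is smooth and never zero.

Transitivity tests the momentum against vector fields `g X`, with `g` a bump function on `M`. Since
`Q` is a topological embedding, small neighbourhoods of `Q(s₀)` in `M` cut out small neighbourhoods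
of `s₀` in `S`, so such fields localize the integral near `s₀` (`exists_bump_integral_ne_zero`). If
`Q(s₀)` lay outside the compact set `Q'(S)`, a bump supported off `Q'(S)` would detect `P(s₀) ≠ 0`
in one momentum and nothing in the other. Hence the images agree: this is where nonvanishing of `P`
enters. Two embeddings with the same image differ by a diffeomorphism `ψ`, because `Q⁻¹ ∘ Q'` and
its inverse are smooth. Now `P'` and `P·ψ` have the same momentum and the same footpoints, and
localizing once more makes them equal pointwise (`eq_of_momentumLeft_eq`). -/

namespace EPDiff

/-! ### Determinants and alternating forms of top degree. -/

section LinearAlgebra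

variable {k : ℕ}

/-- An alternating `k`-form on `ℝᵏ` scales by the determinant under a linear map. -/
theorem alternating_comp_single (f : (EuclideanSpace ℝ (Fin k)) [⋀^Fin k]→L[ℝ] ℝ)
    (A : EuclideanSpace ℝ (Fin k) →L[ℝ] EuclideanSpace ℝ (Fin k)) :
    f (fun i => A (EuclideanSpace.single i (1 : ℝ))) =
      A.det * f (fun i => EuclideanSpace.single i (1 : ℝ)) := by
  let b : Module.Basis (Fin k) ℝ (EuclideanSpace ℝ (Fin k)) :=
    (EuclideanSpace.basisFun (Fin k) ℝ).toBasis
  have hb : ⇑b = fun i => EuclideanSpace.single i (1 : ℝ) := by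
    funext i
    exact EuclideanSpace.basisFun_apply (Fin k) ℝ i
  have key : ∀ w, f.toAlternatingMap w = f.toAlternatingMap b * b.det w := by
    intro w
    conv_lhs => rw [f.toAlternatingMap.eq_smul_basis_det b]
    simp
  have h := key (A.toLinearMap ∘ b)
  rw [b.det_comp, b.det_self, mul_one] at h
  rw [mul_comm, ← hb]
  convert h using 2
  · rw [hb]
    rfl
  · rfl

/-- A nonzero alternating `k`-form on `ℝᵏ` does not vanish on the standard frame. -/
theorem alternating_single_ne_zero {f : (EuclideanSpace ℝ (Fin k)) [⋀^Fin k]→L[ℝ] ℝ}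
    (hf : f ≠ 0) : f (fun i => EuclideanSpace.single i (1 : ℝ)) ≠ 0 := by
  let b : Module.Basis (Fin k) ℝ (EuclideanSpace ℝ (Fin k)) :=
    (EuclideanSpace.basisFun (Fin k) ℝ).toBasis
  have hb : ⇑b = fun i => EuclideanSpace.single i (1 : ℝ) := by
    funext i
    exact EuclideanSpace.basisFun_apply (Fin k) ℝ i
  intro h
  refine hf ?_
  ext w
  have key : f.toAlternatingMap w = f.toAlternatingMap b * b.det w := by
    conv_lhs => rw [f.toAlternatingMap.eq_smul_basis_det b]
    simp
  rw [hb] at key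
  change f w = f _ * _ at key
  rw [key, h]
  simp

/-- The Leibniz expansion in a basis is a polynomial in the matrix entries, which are linear in `A`.
-/
theorem contDiff_det {E : Type*} [NormedAddCommGroup E] [NormedSpace ℝ E]
    [FiniteDimensional ℝ E] {m : WithTop ℕ∞} :
    ContDiff ℝ m (fun A : E →L[ℝ] E => A.det) := by
  let b := Module.finBasis ℝ E
  have h : (fun A : E →L[ℝ] E => A.det) = fun A : E →L[ℝ] E =>
      ∑ σ : Equiv.Perm (Fin (Module.finrank ℝ E)), (Equiv.Perm.sign σ : ℤ) •
        ∏ i, b.coord (σ i) (A (b i)) := by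
    funext A
    rw [ContinuousLinearMap.det, ← LinearMap.det_toMatrix b, Matrix.det_apply]
    simp [LinearMap.toMatrix_apply, Units.smul_def]
  rw [h]
  refine ContDiff.sum fun σ _ => ContDiff.const_smul _ (contDiff_prod fun i _ => ?_)
  have : ContDiff ℝ m fun A : E →L[ℝ] E =>
      (LinearMap.toContinuousLinearMap (b.coord (σ i))) (A (b i)) := by fun_prop
  exact this

end LinearAlgebra

/-! ### The Jacobian function: cocycle identity, nonvanishing, smoothness. -/

namespace VolumeForm

variable {k : ℕ} {S : Type*} [TopologicalSpace S] [ChartedSpace (EuclideanSpace ℝ (Fin k)) S]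

/-- The value of a volume form at a point, as an alternating form on the model space `ℝᵏ`. -/
noncomputable def formModel (μ : VolumeForm k S) (s : S) : (EuclideanSpace ℝ (Fin k)) [⋀^Fin k]→L[ℝ] ℝ :=
  μ.form s

theorem form_stdFrame_ne_zero (μ : VolumeForm k S) (s : S) : μ.form s (stdFrame s) ≠ 0 :=
  alternating_single_ne_zero (f := μ.formModel s) (μ.ne_zero s)

theorem jacobian_refl (μ : VolumeForm k S) (s : S) :
    μ.jacobian (Diffeomorph.refl (𝓡 k) S ∞) s = 1 := by
  rw [jacobian]
  have : (fun i => mfderiv (𝓡 k) (𝓡 k) (Diffeomorph.refl (𝓡 k) S ∞) s (stdFrame s i)) =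
      stdFrame s := by
    funext i
    rw [Diffeomorph.coe_refl, mfderiv_id]
    rfl
  rw [this]
  exact div_self (μ.form_stdFrame_ne_zero s)

/-- By the chain rule, both factors arise from evaluating `μ` on the same pushed-forward frame. This
is the composition law of the action; with `φ = ψ⁻¹` it shows that `J(ψ)` has no zeros. -/
theorem jacobian_trans (μ : VolumeForm k S) (ψ φ : S ≃ₘ^∞⟮𝓡 k, 𝓡 k⟯ S) (s : S) :
    μ.jacobian (ψ.trans φ) s = μ.jacobian φ (ψ s) * μ.jacobian ψ s := by
  have h1 := μ.form_mfderiv (ψ.trans φ) s (stdFrame s)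
  have h2 := μ.form_mfderiv φ (ψ s) (fun i => mfderiv (𝓡 k) (𝓡 k) ψ s (stdFrame s i))
  rw [μ.form_mfderiv ψ s] at h2
  have h3 : mfderiv (𝓡 k) (𝓡 k) (ψ.trans φ) s =
      (mfderiv (𝓡 k) (𝓡 k) φ (ψ s)).comp (mfderiv (𝓡 k) (𝓡 k) ψ s) := by
    rw [Diffeomorph.coe_trans]
    exact mfderiv_comp s (φ.mdifferentiable (by simp) _) (ψ.mdifferentiable (by simp) _)
  rw [h3] at h1
  have h4 := h1.symm.trans h2
  rw [← mul_assoc] at h4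
  exact mul_right_cancel₀ (μ.form_stdFrame_ne_zero s) h4

theorem jacobian_ne_zero (μ : VolumeForm k S) (ψ : S ≃ₘ^∞⟮𝓡 k, 𝓡 k⟯ S) (s : S) :
    μ.jacobian ψ s ≠ 0 := by
  intro h
  have := μ.jacobian_trans ψ ψ.symm s
  rw [Diffeomorph.self_trans_symm, jacobian_refl, h, mul_zero] at this
  exact one_ne_zero this

/-- The domain of the coordinate representation of `ψ` in the charts at `x` and `x'`. -/
noncomputable def coordDomain (ψ : S ≃ₘ^∞⟮𝓡 k, 𝓡 k⟯ S) (x x' : S) : Set (EuclideanSpace ℝ (Fin k)) :=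
  (extChartAt (𝓡 k) x).target ∩
    (extChartAt (𝓡 k) x).symm ⁻¹' (ψ ⁻¹' (extChartAt (𝓡 k) x').source)

/-- The coordinate representation of `ψ` in the charts at `x` and `x'`. -/
noncomputable def coordRep (ψ : S ≃ₘ^∞⟮𝓡 k, 𝓡 k⟯ S) (x x' : S) (y : EuclideanSpace ℝ (Fin k)) :
    EuclideanSpace ℝ (Fin k) :=
  extChartAt (𝓡 k) x' (ψ ((extChartAt (𝓡 k) x).symm y))

theorem isOpen_coordDomain (ψ : S ≃ₘ^∞⟮𝓡 k, 𝓡 k⟯ S) (x x' : S) :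
    IsOpen (coordDomain ψ x x') :=
  (continuousOn_extChartAt_symm x).isOpen_inter_preimage (isOpen_extChartAt_target x)
    ((isOpen_extChartAt_source x').preimage ψ.continuous)

variable [IsManifold (𝓡 k) ∞ S]

theorem mdifferentiableAt_extChartAt_symm {x : S} {y : EuclideanSpace ℝ (Fin k)}
    (hy : y ∈ (extChartAt (𝓡 k) x).target) :
    MDifferentiableAt (𝓡 k) (𝓡 k) (extChartAt (𝓡 k) x).symm y := by
  have := IsManifold.of_le (I := 𝓡 k) (M := S) (m := 1) (n := ∞) (by simp)
  have h := mdifferentiableWithinAt_extChartAt_symm (I := 𝓡 k) hy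
  rwa [ModelWithCorners.range_eq_univ, mdifferentiableWithinAt_univ] at h

/-- The coefficient is `μ` on the standard frame times the determinant of the derivative of the
inverse chart, which is invertible. -/
theorem coeff_ne_zero (μ : VolumeForm k S) {x : S} {y : EuclideanSpace ℝ (Fin k)}
    (hy : y ∈ (extChartAt (𝓡 k) x).target) : μ.coeff x y ≠ 0 := by
  have := IsManifold.of_le (I := 𝓡 k) (M := S) (m := 1) (n := ∞) (by simp)
  have h0 := isInvertible_mfderivWithin_extChartAt_symm (I := 𝓡 k) hy
  rw [ModelWithCorners.range_eq_univ, mfderivWithin_univ] at h0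
  let A : EuclideanSpace ℝ (Fin k) →L[ℝ] EuclideanSpace ℝ (Fin k) :=
    mfderiv (𝓡 k) (𝓡 k) (extChartAt (𝓡 k) x).symm y
  have h1 : μ.coeff x y = A.det * μ.form ((extChartAt (𝓡 k) x).symm y) (stdFrame _) :=
    alternating_comp_single (μ.formModel ((extChartAt (𝓡 k) x).symm y)) A
  rw [h1]
  refine mul_ne_zero ?_ (μ.form_stdFrame_ne_zero _)
  obtain ⟨e, he⟩ := h0
  let e' : EuclideanSpace ℝ (Fin k) ≃L[ℝ] EuclideanSpace ℝ (Fin k) := e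
  have h2 : A = (e' : EuclideanSpace ℝ (Fin k) →L[ℝ] EuclideanSpace ℝ (Fin k)) := he.symm
  rw [h2]
  exact (LinearEquiv.isUnit_det' e'.toLinearEquiv).ne_zero

theorem contMDiffOn_coordRep (ψ : S ≃ₘ^∞⟮𝓡 k, 𝓡 k⟯ S) (x x' : S) :
    ContMDiffOn (𝓡 k) (𝓡 k) ∞ (coordRep ψ x x') (coordDomain ψ x x') := by
  refine (contMDiffOn_extChartAt (I := 𝓡 k) (x := x')).comp
    (t := (chartAt (EuclideanSpace ℝ (Fin k)) x').source) ?_ ?_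
  · exact ψ.contMDiff.comp_contMDiffOn ((contMDiffOn_extChartAt_symm x).mono inter_subset_left)
  · intro y hy
    have := hy.2
    rwa [mem_preimage, mem_preimage, extChartAt_source] at this

theorem contDiffOn_coordRep (ψ : S ≃ₘ^∞⟮𝓡 k, 𝓡 k⟯ S) (x x' : S) :
    ContDiffOn ℝ ∞ (coordRep ψ x x') (coordDomain ψ x x') :=
  (contMDiffOn_coordRep ψ x x').contDiffOn

/-- This is `ψ^*μ = J(ψ) μ` in coordinates. It links `J(ψ)` both to smooth chart data and to the
Euclidean substitution rule. -/
theorem coeff_coordRep (μ : VolumeForm k S) (ψ : S ≃ₘ^∞⟮𝓡 k, 𝓡 k⟯ S) {x x' : S}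
    {y : EuclideanSpace ℝ (Fin k)} (hy : y ∈ coordDomain ψ x x') :
    (fderiv ℝ (coordRep ψ x x') y).det * μ.coeff x' (coordRep ψ x x' y) =
      μ.jacobian ψ ((extChartAt (𝓡 k) x).symm y) * μ.coeff x y := by
  set φ := extChartAt (𝓡 k) x
  set φ' := extChartAt (𝓡 k) x'
  set T := coordRep ψ x x'
  have hnhds := (isOpen_coordDomain ψ x x').mem_nhds hy
  have hTy : T y ∈ φ'.target := φ'.map_source hy.2
  have hinv : φ'.symm (T y) = ψ (φ.symm y) := φ'.left_inv hy.2
  let D : EuclideanSpace ℝ (Fin k) →L[ℝ] EuclideanSpace ℝ (Fin k) := fderiv ℝ T y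
  let A' : EuclideanSpace ℝ (Fin k) →L[ℝ] EuclideanSpace ℝ (Fin k) :=
    mfderiv (𝓡 k) (𝓡 k) φ'.symm (T y)
  let A : EuclideanSpace ℝ (Fin k) →L[ℝ] EuclideanSpace ℝ (Fin k) :=
    mfderiv (𝓡 k) (𝓡 k) φ.symm y
  let Ψ : EuclideanSpace ℝ (Fin k) →L[ℝ] EuclideanSpace ℝ (Fin k) :=
    mfderiv (𝓡 k) (𝓡 k) ψ (φ.symm y)
  have hT : MDifferentiableAt (𝓡 k) (𝓡 k) T y :=
    ((contMDiffOn_coordRep ψ x x').contMDiffAt hnhds).mdifferentiableAt (by simp)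
  -- Differentiate `φ'⁻¹ ∘ T = ψ ∘ φ⁻¹`, valid near `y`; taking determinants then gives the claim.
  have hcomp : A'.comp D = Ψ.comp A := by
    have h1 : mfderiv (𝓡 k) (𝓡 k) (φ'.symm ∘ T) y = A'.comp (mfderiv (𝓡 k) (𝓡 k) T y) :=
      mfderiv_comp y (mdifferentiableAt_extChartAt_symm hTy) hT
    have h2 : mfderiv (𝓡 k) (𝓡 k) (ψ ∘ φ.symm) y = Ψ.comp A :=
      mfderiv_comp y (ψ.mdifferentiable (by simp) _) (mdifferentiableAt_extChartAt_symm hy.1)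
    have h3 : φ'.symm ∘ T =ᶠ[𝓝 y] ψ ∘ φ.symm := by
      filter_upwards [hnhds] with z hz
      exact φ'.left_inv hz.2
    rw [mfderiv_eq_fderiv] at h1
    exact h1.symm.trans ((h3.mfderiv_eq).trans h2)
  have e1 : μ.coeff x' (T y) =
      A'.det * μ.formModel (ψ (φ.symm y)) (fun i => EuclideanSpace.single i (1 : ℝ)) := by
    rw [← hinv]
    exact alternating_comp_single (μ.formModel (φ'.symm (T y))) A'
  have e2 : μ.jacobian ψ (φ.symm y) * μ.coeff x y = (Ψ.comp A).det *
      μ.formModel (ψ (φ.symm y)) (fun i => EuclideanSpace.single i (1 : ℝ)) := by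
    rw [← alternating_comp_single]
    exact (μ.form_mfderiv ψ (φ.symm y) (chartFrame x y)).symm
  have e3 : (A'.comp D).det = A'.det * D.det := LinearMap.det_comp _ _
  rw [e2, ← hcomp, e3, e1]
  ring

/-- Solving `coeff_coordRep` for `J(ψ)` exhibits it locally as a quotient of smooth functions with
nonvanishing denominator. -/
theorem contMDiff_jacobian (μ : VolumeForm k S) (ψ : S ≃ₘ^∞⟮𝓡 k, 𝓡 k⟯ S) :
    ContMDiff (𝓡 k) 𝓘(ℝ) ∞ (μ.jacobian ψ) := by
  intro s
  set φ := extChartAt (𝓡 k) s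
  set T := coordRep ψ s (ψ s)
  have hs : φ s ∈ coordDomain ψ s (ψ s) := by
    refine ⟨mem_extChartAt_target s, ?_⟩
    rw [mem_preimage, extChartAt_to_inv]
    exact mem_extChartAt_source (ψ s)
  have hU := isOpen_coordDomain ψ s (ψ s)
  have hT := contDiffOn_coordRep ψ s (ψ s)
  have hD : ContDiffOn ℝ ∞ (fun y => (fderiv ℝ T y).det) (coordDomain ψ s (ψ s)) :=
    contDiff_det.comp_contDiffOn (hT.fderiv_of_isOpen hU (by simp))
  have hN : ContDiffOn ℝ ∞ (fun y => (fderiv ℝ T y).det * μ.coeff (ψ s) (T y) / μ.coeff s y)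
      (coordDomain ψ s (ψ s)) := by
    refine (hD.mul ((μ.smooth (ψ s)).comp hT ?_)).div ((μ.smooth s).mono inter_subset_left) ?_
    · intro y hy
      exact (extChartAt (𝓡 k) (ψ s)).map_source hy.2
    · intro y hy
      exact μ.coeff_ne_zero hy.1
  have hc := (hN.contDiffAt (hU.mem_nhds hs)).contMDiffAt.comp s (contMDiffAt_extChartAt (I := 𝓡 k))
  refine hc.congr_of_eventuallyEq ?_
  have hpre : φ ⁻¹' coordDomain ψ s (ψ s) ∈ 𝓝 s :=
    (continuousAt_extChartAt s).preimage_mem_nhds (hU.mem_nhds hs)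
  filter_upwards [hpre, extChartAt_source_mem_nhds (I := 𝓡 k) s] with t ht hts
  have h := μ.coeff_coordRep ψ ht
  rw [φ.left_inv hts] at h
  rw [Function.comp_apply, h]
  exact (mul_div_cancel_right₀ _ (μ.coeff_ne_zero ht.1)).symm

theorem contMDiff_abs_jacobian (μ : VolumeForm k S) (ψ : S ≃ₘ^∞⟮𝓡 k, 𝓡 k⟯ S) :
    ContMDiff (𝓡 k) 𝓘(ℝ) ∞ (fun s => |μ.jacobian ψ s|) := fun s =>
  (contDiffAt_abs (μ.jacobian_ne_zero ψ s)).contMDiffAt.comp s (μ.contMDiff_jacobian ψ s)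

end VolumeForm

end EPDiff

namespace EPDiff

/-! ### Change of variables and positivity for the measure of a volume form. -/

namespace VolumeForm

variable {k : ℕ} {S : Type*} [TopologicalSpace S] [ChartedSpace (EuclideanSpace ℝ (Fin k)) S]

theorem image_coordRep (ψ : S ≃ₘ^∞⟮𝓡 k, 𝓡 k⟯ S) (x x' : S) :
    coordRep ψ x x' '' coordDomain ψ x x' = coordDomain ψ.symm x' x := by
  ext z
  constructor
  · rintro ⟨y, hy, rfl⟩
    refine ⟨(extChartAt (𝓡 k) x').map_source hy.2, ?_⟩
    rw [mem_preimage, mem_preimage, coordRep, (extChartAt (𝓡 k) x').left_inv hy.2,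
      ψ.symm_apply_apply]
    exact (extChartAt (𝓡 k) x).map_target hy.1
  · intro hz
    refine ⟨coordRep ψ.symm x' x z, ⟨(extChartAt (𝓡 k) x).map_source hz.2, ?_⟩, ?_⟩
    · rw [mem_preimage, mem_preimage, coordRep, (extChartAt (𝓡 k) x).left_inv hz.2,
        ψ.apply_symm_apply]
      exact (extChartAt (𝓡 k) x').map_target hz.1
    · rw [coordRep, coordRep, (extChartAt (𝓡 k) x).left_inv hz.2, ψ.apply_symm_apply,
        (extChartAt (𝓡 k) x').right_inv hz.1]

theorem injOn_coordRep (ψ : S ≃ₘ^∞⟮𝓡 k, 𝓡 k⟯ S) (x x' : S) :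
    InjOn (coordRep ψ x x') (coordDomain ψ x x') := by
  intro y hy z hz h
  have h1 := (extChartAt (𝓡 k) x').injOn hy.2 hz.2 h
  exact (extChartAt (𝓡 k) x).symm.injOn hy.1 hz.1 (ψ.injective h1)

theorem aemeasurable_coeff (μ : VolumeForm k S) (x : S) :
    AEMeasurable (μ.coeff x) (volume.restrict (extChartAt (𝓡 k) x).target) :=
  (μ.smooth x).continuousOn.aemeasurable (isOpen_extChartAt_target x).measurableSet

theorem aemeasurable_extChartAt_symm [MeasurableSpace S] [BorelSpace S] (x : S) :
    AEMeasurable (extChartAt (𝓡 k) x).symm (volume.restrict (extChartAt (𝓡 k) x).target) :=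
  (continuousOn_extChartAt_symm x).aemeasurable (isOpen_extChartAt_target x).measurableSet

theorem aemeasurable_comp_extChartAt_symm [MeasurableSpace S] [BorelSpace S]
    {f : S → ENNReal} (hf : Measurable f) (x : S) :
    AEMeasurable (fun y => f ((extChartAt (𝓡 k) x).symm y))
      (volume.restrict (extChartAt (𝓡 k) x).target) :=
  hf.comp_aemeasurable (aemeasurable_extChartAt_symm x)

variable [IsManifold (𝓡 k) ∞ S]

/-- Change of variables for a volume form under a diffeomorphism, in a pair of charts. -/
theorem lintegral_coordDomain_symm (μ : VolumeForm k S) (ψ : S ≃ₘ^∞⟮𝓡 k, 𝓡 k⟯ S) (x x' : S)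
    (f : S → ENNReal) :
    ∫⁻ z in coordDomain ψ.symm x' x,
        ENNReal.ofReal |μ.coeff x' z| * f ((extChartAt (𝓡 k) x').symm z) =
      ∫⁻ y in coordDomain ψ x x', ENNReal.ofReal |μ.coeff x y| *
        (ENNReal.ofReal |μ.jacobian ψ ((extChartAt (𝓡 k) x).symm y)| *
          f (ψ ((extChartAt (𝓡 k) x).symm y))) := by
  have hU := isOpen_coordDomain ψ x x'
  rw [← image_coordRep ψ x x', lintegral_image_eq_lintegral_abs_det_fderiv_mul volume
    hU.measurableSet (fun y hy => (((contDiffOn_coordRep ψ x x').contDiffAt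
      (hU.mem_nhds hy)).differentiableAt (by simp)).hasFDerivAt.hasFDerivWithinAt)
    (injOn_coordRep ψ x x')]
  refine setLIntegral_congr_fun hU.measurableSet fun y hy => ?_
  have h := congrArg abs (μ.coeff_coordRep ψ hy)
  rw [abs_mul, abs_mul] at h
  have h' : (extChartAt (𝓡 k) x').symm (coordRep ψ x x' y) =
      ψ ((extChartAt (𝓡 k) x).symm y) := (extChartAt (𝓡 k) x').left_inv hy.2
  simp only [h']
  rw [← mul_assoc, ← mul_assoc, ← ENNReal.ofReal_mul (abs_nonneg _),
    ← ENNReal.ofReal_mul (abs_nonneg _), h, mul_comm |μ.jacobian ψ _|]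

variable [CompactSpace S] [T2Space S]

/-- The finitely many indices of nonzero functions of the partition of unity. -/
noncomputable def partitionIndices (k : ℕ) (S : Type*) [TopologicalSpace S]
    [ChartedSpace (EuclideanSpace ℝ (Fin k)) S] [IsManifold (𝓡 k) ∞ S] [CompactSpace S]
    [T2Space S] : Finset S :=
  (partition k S).locallyFinite.finite_nonempty_of_compact.toFinset

theorem partition_eq_zero {x : S} (hx : x ∉ partitionIndices k S) (s : S) :
    partition k S x s = 0 := by
  by_contra h
  exact hx (((partition k S).locallyFinite.finite_nonempty_of_compact).mem_toFinset.2 ⟨s, h⟩)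

theorem sum_partition (s : S) : ∑ x ∈ partitionIndices k S, partition k S x s = 1 := by
  rw [← (partition k S).sum_eq_one (mem_univ s), finsum_eq_sum_of_support_subset]
  intro x hx
  by_contra h
  exact hx (partition_eq_zero h s)

theorem sum_ofReal_partition (s : S) :
    ∑ x ∈ partitionIndices k S, ENNReal.ofReal (partition k S x s) = 1 := by
  rw [← ENNReal.ofReal_sum_of_nonneg fun x _ => (partition k S).nonneg x s, sum_partition,
    ENNReal.ofReal_one]

theorem mem_source_of_partition_ne_zero {x s : S} (h : partition k S x s ≠ 0) :
    s ∈ (extChartAt (𝓡 k) x).source := by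
  rw [extChartAt_source]
  exact partition_subordinate x (subset_tsupport _ h)

/-- A term of the double partition sum can be integrated over the domain where both functions of
the partition can be nonzero. -/
theorem lintegral_target_eq_coordDomain (ψ : S ≃ₘ^∞⟮𝓡 k, 𝓡 k⟯ S) (x x' : S)
    {g : EuclideanSpace ℝ (Fin k) → ENNReal}
    (hg : ∀ y, partition k S x' (ψ ((extChartAt (𝓡 k) x).symm y)) = 0 → g y = 0) :
    ∫⁻ y in (extChartAt (𝓡 k) x).target, g y = ∫⁻ y in coordDomain ψ x x', g y := by
  rw [← lintegral_indicator (isOpen_extChartAt_target x).measurableSet,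
    ← lintegral_indicator (isOpen_coordDomain ψ x x').measurableSet]
  refine lintegral_congr fun y => ?_
  by_cases hy : y ∈ coordDomain ψ x x'
  · rw [indicator_of_mem hy, indicator_of_mem hy.1]
  · rw [indicator_of_notMem hy]
    by_cases hy' : y ∈ (extChartAt (𝓡 k) x).target
    · rw [indicator_of_mem hy']
      refine hg y ?_
      by_contra h
      exact hy ⟨hy', mem_source_of_partition_ne_zero h⟩
    · rw [indicator_of_notMem hy']

variable [MeasurableSpace S] [BorelSpace S]

theorem measurable_partition (x : S) : Measurable (partition k S x) :=
  (partition k S x).contMDiff.continuous.measurable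

theorem aemeasurable_density (μ : VolumeForm k S) (x : S) :
    AEMeasurable (fun y => ENNReal.ofReal
      (partition k S x ((extChartAt (𝓡 k) x).symm y) * |μ.coeff x y|))
      (volume.restrict (extChartAt (𝓡 k) x).target) :=
  (((measurable_partition x).comp_aemeasurable (aemeasurable_extChartAt_symm x)).mul
    (μ.aemeasurable_coeff x).norm).ennreal_ofReal

theorem lintegral_chartMeasure (μ : VolumeForm k S) (x : S) {f : S → ENNReal}
    (hf : Measurable f) :
    ∫⁻ s, f s ∂μ.chartMeasure x = ∫⁻ y in (extChartAt (𝓡 k) x).target,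
      ENNReal.ofReal |μ.coeff x y| * (ENNReal.ofReal
        (partition k S x ((extChartAt (𝓡 k) x).symm y)) * f ((extChartAt (𝓡 k) x).symm y)) := by
  have h1 := (aemeasurable_extChartAt_symm x).mono_ac (withDensity_absolutelyContinuous
    (volume.restrict (extChartAt (𝓡 k) x).target) (fun y => ENNReal.ofReal
      (partition k S x ((extChartAt (𝓡 k) x).symm y) * |μ.coeff x y|)))
  rw [chartMeasure, lintegral_map' hf.aemeasurable h1,
    lintegral_withDensity_eq_lintegral_mul₀ (μ.aemeasurable_density x)
      (aemeasurable_comp_extChartAt_symm hf x)]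
  refine lintegral_congr fun y => ?_
  rw [Pi.mul_apply, ENNReal.ofReal_mul ((partition k S).nonneg x _)]
  ring

theorem lintegral_measure (μ : VolumeForm k S) {f : S → ENNReal} (hf : Measurable f) :
    ∫⁻ s, f s ∂μ.measure = ∑ x ∈ partitionIndices k S, ∫⁻ s, f s ∂μ.chartMeasure x := by
  rw [measure, lintegral_sum_measure, tsum_eq_sum]
  intro x hx
  rw [lintegral_chartMeasure μ x hf]
  simp [partition_eq_zero hx]

/-- Integration against `μ` written as a double sum over the partition of unity and its pullback
by a diffeomorphism. -/
theorem lintegral_measure_eq_sum_sum (μ : VolumeForm k S) (ψ : S ≃ₘ^∞⟮𝓡 k, 𝓡 k⟯ S)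
    {f : S → ENNReal} (hf : Measurable f) :
    ∫⁻ s, f s ∂μ.measure = ∑ x ∈ partitionIndices k S, ∑ x' ∈ partitionIndices k S,
      ∫⁻ y in coordDomain ψ x x', ENNReal.ofReal |μ.coeff x y| *
        (ENNReal.ofReal (partition k S x ((extChartAt (𝓡 k) x).symm y)) *
          ENNReal.ofReal (partition k S x' (ψ ((extChartAt (𝓡 k) x).symm y))) *
          f ((extChartAt (𝓡 k) x).symm y)) := by
  rw [lintegral_measure μ hf]
  refine Finset.sum_congr rfl fun x _ => ?_
  rw [lintegral_chartMeasure μ x hf]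
  have hmeas : ∀ x', AEMeasurable (fun y => ENNReal.ofReal |μ.coeff x y| *
      (ENNReal.ofReal (partition k S x ((extChartAt (𝓡 k) x).symm y)) *
        ENNReal.ofReal (partition k S x' (ψ ((extChartAt (𝓡 k) x).symm y))) *
        f ((extChartAt (𝓡 k) x).symm y)))
      (volume.restrict (extChartAt (𝓡 k) x).target) := fun x' =>
    (μ.aemeasurable_coeff x).norm.ennreal_ofReal.mul (aemeasurable_comp_extChartAt_symm
      (f := fun s => ENNReal.ofReal (partition k S x s) *
        ENNReal.ofReal (partition k S x' (ψ s)) * f s)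
      (((measurable_partition x).ennreal_ofReal.mul
        ((measurable_partition x').comp ψ.continuous.measurable).ennreal_ofReal).mul hf) x)
  have hsum : ∀ x', ∫⁻ y in coordDomain ψ x x', ENNReal.ofReal |μ.coeff x y| *
        (ENNReal.ofReal (partition k S x ((extChartAt (𝓡 k) x).symm y)) *
          ENNReal.ofReal (partition k S x' (ψ ((extChartAt (𝓡 k) x).symm y))) *
          f ((extChartAt (𝓡 k) x).symm y)) =
      ∫⁻ y in (extChartAt (𝓡 k) x).target, ENNReal.ofReal |μ.coeff x y| *
        (ENNReal.ofReal (partition k S x ((extChartAt (𝓡 k) x).symm y)) *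
          ENNReal.ofReal (partition k S x' (ψ ((extChartAt (𝓡 k) x).symm y))) *
          f ((extChartAt (𝓡 k) x).symm y)) := fun x' =>
    (lintegral_target_eq_coordDomain ψ x x' fun y hy => by rw [hy]; simp).symm
  simp only [hsum]
  rw [← lintegral_finsetSum' _ fun x' _ => hmeas x']
  refine lintegral_congr fun y => ?_
  -- The inserted factors `ρₓ' ∘ ψ` sum to 1.
  rw [← Finset.mul_sum, ← Finset.sum_mul, ← Finset.mul_sum, sum_ofReal_partition, mul_one]

/-- Change of variables: `∫ |J(ψ)| (f ∘ ψ) μ = ∫ f μ`. -/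
theorem lintegral_jacobian_mul_comp (μ : VolumeForm k S) (ψ : S ≃ₘ^∞⟮𝓡 k, 𝓡 k⟯ S)
    {f : S → ENNReal} (hf : Measurable f) :
    ∫⁻ s, ENNReal.ofReal |μ.jacobian ψ s| * f (ψ s) ∂μ.measure = ∫⁻ s, f s ∂μ.measure := by
  have hJ : Measurable fun s => ENNReal.ofReal |μ.jacobian ψ s| :=
    (μ.contMDiff_abs_jacobian ψ).continuous.measurable.ennreal_ofReal
  have h0 := μ.lintegral_measure_eq_sum_sum ψ
    (f := fun s => ENNReal.ofReal |μ.jacobian ψ s| * f (ψ s))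
    (hJ.mul (hf.comp ψ.continuous.measurable))
  -- Refining one side by `ψ` and the other by `ψ⁻¹` makes both double sums run over the same pairs
  -- of charts, so they match term by term after the swap.
  rw [h0, μ.lintegral_measure_eq_sum_sum ψ.symm hf, Finset.sum_comm]
  refine Finset.sum_congr rfl fun x' _ => Finset.sum_congr rfl fun x _ => ?_
  have h := μ.lintegral_coordDomain_symm ψ x x' fun s =>
    ENNReal.ofReal (partition k S x' s) * ENNReal.ofReal (partition k S x (ψ.symm s)) * f s
  rw [h]
  refine lintegral_congr fun y => ?_
  rw [ψ.symm_apply_apply]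
  ring

/-- As an identity of measures, the formula passes from `ENNReal`-valued to real-valued integrands.
-/
theorem map_withDensity_jacobian (μ : VolumeForm k S) (ψ : S ≃ₘ^∞⟮𝓡 k, 𝓡 k⟯ S) :
    (μ.measure.withDensity fun s => ENNReal.ofReal |μ.jacobian ψ s|).map ψ = μ.measure := by
  have hJ : Measurable fun s => ENNReal.ofReal |μ.jacobian ψ s| :=
    (μ.contMDiff_abs_jacobian ψ).continuous.measurable.ennreal_ofReal
  refine Measure.ext_of_lintegral _ fun f hf => ?_
  rw [lintegral_map hf ψ.continuous.measurable]
  refine (lintegral_withDensity_eq_lintegral_mul _ hJ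
    (hf.comp ψ.continuous.measurable)).trans ?_
  exact μ.lintegral_jacobian_mul_comp ψ hf

theorem integral_jacobian_mul_comp (μ : VolumeForm k S) (ψ : S ≃ₘ^∞⟮𝓡 k, 𝓡 k⟯ S)
    {f : S → ℝ} (hf : Continuous f) :
    ∫ s, |μ.jacobian ψ s| * f (ψ s) ∂μ.measure = ∫ s, f s ∂μ.measure := by
  have hJ : Measurable fun s => |μ.jacobian ψ s|.toNNReal :=
    (μ.contMDiff_abs_jacobian ψ).continuous.measurable.real_toNNReal
  conv_rhs => rw [← μ.map_withDensity_jacobian ψ]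
  rw [integral_map ψ.continuous.measurable.aemeasurable hf.measurable.aestronglyMeasurable]
  have h := integral_withDensity_eq_integral_smul (μ := μ.measure) hJ (fun s => f (ψ s))
  refine Eq.trans ?_ h.symm
  refine integral_congr_ae (Filter.Eventually.of_forall fun s => ?_)
  simp [NNReal.smul_def]

/-- Some `ρₓ` is nonzero at a given point of `U`. In that chart the density `ρₓ |a|` is positive on
a nonempty open set `V`, which has positive Lebesgue measure. -/
theorem measure_isOpen_pos (μ : VolumeForm k S) {U : Set S} (hU : IsOpen U) (hne : U.Nonempty) :
    0 < μ.measure U := by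
  obtain ⟨s, hs⟩ := hne
  obtain ⟨x, hx⟩ : ∃ x, partition k S x s ≠ 0 := by
    by_contra! h
    have := sum_partition (k := k) s
    simp [h] at this
  set φ := extChartAt (𝓡 k) x
  have hsφ : s ∈ φ.source := mem_source_of_partition_ne_zero hx
  set V : Set (EuclideanSpace ℝ (Fin k)) :=
    φ.target ∩ φ.symm ⁻¹' (U ∩ {t | partition k S x t ≠ 0})
  have hV : IsOpen V := (continuousOn_extChartAt_symm x).isOpen_inter_preimage
    (isOpen_extChartAt_target x) (hU.inter
      (isOpen_ne_fun (partition k S x).contMDiff.continuous continuous_const))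
  have hsV : φ s ∈ V := by
    refine ⟨φ.map_source hsφ, ?_⟩
    rw [mem_preimage, φ.left_inv hsφ]
    exact ⟨hs, hx⟩
  have hle : μ.chartMeasure x U ≤ μ.measure U := Measure.le_sum _ x U
  refine lt_of_lt_of_le (pos_iff_ne_zero.2 fun h0 => ?_) hle
  have h1 := μ.lintegral_chartMeasure x (f := U.indicator 1)
    (measurable_one.indicator hU.measurableSet)
  rw [lintegral_indicator_one hU.measurableSet, h0] at h1
  have h3 := (lintegral_eq_zero_iff' ((μ.aemeasurable_coeff x).norm.ennreal_ofReal.mul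
    (aemeasurable_comp_extChartAt_symm
      (f := fun s => ENNReal.ofReal (partition k S x s) * U.indicator 1 s)
      ((measurable_partition x).ennreal_ofReal.mul
        (measurable_one.indicator hU.measurableSet)) x))).1 h1.symm
  rw [Filter.EventuallyEq, ae_restrict_iff' (isOpen_extChartAt_target x).measurableSet] at h3
  have h4 : volume V = 0 := by
    refine measure_mono_null (fun y hy => ?_) (ae_iff.1 h3)
    intro h
    have h5 := h hy.1
    have h6 : 0 < partition k S x (φ.symm y) :=
      lt_of_le_of_ne ((partition k S).nonneg x _) (Ne.symm hy.2.2)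
    have h7 : 0 < |μ.coeff x y| := abs_pos.2 (μ.coeff_ne_zero hy.1)
    simp only [Pi.mul_apply, Real.norm_eq_abs, Pi.zero_apply, mul_eq_zero, ENNReal.ofReal_eq_zero, not_le.2 h7, false_or] at h5
    rcases h5 with h5 | h5
    · exact absurd h5 (not_le.2 h6)
    · rw [indicator_of_mem hy.2.1] at h5
      exact one_ne_zero h5
  exact (hV.measure_pos volume ⟨_, hsV⟩).ne' h4

theorem isOpenPosMeasure_measure (μ : VolumeForm k S) : μ.measure.IsOpenPosMeasure :=
  ⟨fun _ hU hne => (μ.measure_isOpen_pos hU hne).ne'⟩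

/-- A continuous nonnegative function that is positive at some point has positive integral. -/
theorem integral_pos (μ : VolumeForm k S) {f : S → ℝ} (hf : Continuous f) (h0 : ∀ s, 0 ≤ f s)
    {s : S} (hs : 0 < f s) : 0 < ∫ s, f s ∂μ.measure := by
  have := μ.isFiniteMeasure_measure
  have := μ.isOpenPosMeasure_measure
  exact hf.integral_pos_of_hasCompactSupport_nonneg_nonzero
    (HasCompactSupport.of_compactSpace _) h0 hs.ne'

end VolumeForm

end EPDiff

namespace EPDiff

/-! ### Reparametrization of smooth embeddings. -/

section Embeddings

variable {k n : ℕ} {S : Type*} [TopologicalSpace S] [ChartedSpace (EuclideanSpace ℝ (Fin k)) S]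
  {M : Type*} [TopologicalSpace M] [ChartedSpace (EuclideanSpace ℝ (Fin n)) M]

theorem isSmoothEmbedding_comp_diffeomorph [IsManifold (𝓡 k) ∞ S] {f : S → M}
    (hf : IsSmoothEmbedding (𝓡 k) (𝓡 n) ∞ f) (ψ : S ≃ₘ^∞⟮𝓡 k, 𝓡 k⟯ S) :
    IsSmoothEmbedding (𝓡 k) (𝓡 n) ∞ (f ∘ ψ) := by
  refine ⟨?_, hf.isEmbedding.comp ψ.toHomeomorph.isEmbedding⟩
  obtain ⟨F, i1, i2, h⟩ := hf.isImmersion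
  refine ⟨F, i1, i2, fun s => ?_⟩
  have hs := h (ψ s)
  -- Precomposing the domain chart with `ψ` and keeping the codomain chart leaves the local normal
  -- form of the immersion unchanged.
  refine IsImmersionAtOfComplement.mk_of_charts hs.equiv
    (ψ.toHomeomorph.transOpenPartialHomeomorph hs.domChart) hs.codChart
    hs.mem_domChart_source hs.mem_codChart_source ?_ hs.codChart_mem_maximalAtlas
    (fun t ht => hs.source_subset_preimage_source ht) ?_
  · refine OpenPartialHomeomorph.mem_maximalAtlas_of_contMDiffOn _ ?_ ?_
    · exact (contMDiffOn_of_mem_maximalAtlas hs.domChart_mem_maximalAtlas).comp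
        ψ.contMDiff.contMDiffOn (fun t ht => ht)
    · exact ψ.symm.contMDiff.comp_contMDiffOn
        (contMDiffOn_symm_of_mem_maximalAtlas hs.domChart_mem_maximalAtlas)
  · intro y hy
    have hy' : y ∈ (hs.domChart.extend (𝓡 k)).target := hy
    rw [← hs.writtenInCharts hy']
    exact congrArg (fun t => hs.codChart.extend (𝓡 n) (f t))
      (ψ.apply_symm_apply ((hs.domChart.extend (𝓡 k)).symm y))

/-- A smooth map into the image of a smooth embedding factors smoothly through the embedding. -/
theorem exists_contMDiff_comp_eq {Q Q' : S → M} (hQ : IsSmoothEmbedding (𝓡 k) (𝓡 n) ∞ Q)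
    (hQ' : ContMDiff (𝓡 k) (𝓡 n) ∞ Q') (hr : range Q' ⊆ range Q) :
    ∃ h : S → S, ContMDiff (𝓡 k) (𝓡 k) ∞ h ∧ ∀ s, Q (h s) = Q' s := by
  choose h hh using fun s => hr (mem_range_self s)
  have hcomp : Q ∘ h = Q' := funext hh
  -- An immersion detects smoothness only of continuous maps; continuity of `h` comes from `Q` being
  -- a topological embedding.
  refine ⟨h, (ContMDiff.iff_comp_isImmersion hQ.isImmersion).2 ⟨?_, ?_⟩, hh⟩
  · rw [hQ.isEmbedding.continuous_iff, hcomp]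
    exact hQ'.continuous
  · rwa [hcomp]

/-- Two smooth embeddings with the same image differ by a diffeomorphism of their source. -/
theorem exists_diffeomorph_comp_eq {Q Q' : S → M} (hQ : IsSmoothEmbedding (𝓡 k) (𝓡 n) ∞ Q)
    (hQ' : IsSmoothEmbedding (𝓡 k) (𝓡 n) ∞ Q') (hr : range Q = range Q') :
    ∃ ψ : S ≃ₘ^∞⟮𝓡 k, 𝓡 k⟯ S, Q' = Q ∘ ψ := by
  obtain ⟨h, hs, hh⟩ := exists_contMDiff_comp_eq hQ hQ'.contMDiff hr.symm.subset
  obtain ⟨h', hs', hh'⟩ := exists_contMDiff_comp_eq hQ' hQ.contMDiff hr.subset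
  refine ⟨⟨⟨h, h', fun s => hQ'.isEmbedding.injective ?_, fun s => hQ.isEmbedding.injective ?_⟩,
    hs, hs'⟩, funext fun s => (hh s).symm⟩
  · rw [hh', hh]
  · rw [hh, hh']

end Embeddings

/-! ### Bump functions and globally defined vector fields. -/

section VectorFields

variable {n : ℕ} {M : Type*} [TopologicalSpace M] [ChartedSpace (EuclideanSpace ℝ (Fin n)) M]
  [IsManifold (𝓡 n) ∞ M] [T2Space M]

theorem exists_bump {p : M} {O : Set M} (hO : O ∈ 𝓝 p) :
    ∃ g : M → ℝ, ContMDiff (𝓡 n) 𝓘(ℝ) ∞ g ∧ (∀ q, 0 ≤ g q) ∧ g p = 1 ∧ tsupport g ⊆ O := by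
  obtain ⟨f, -, hf⟩ := (SmoothBumpFunction.nhds_basis_tsupport (I := 𝓡 n) p).mem_iff.1 hO
  exact ⟨f, f.contMDiff, fun q => f.nonneg, f.eq_one, hf⟩

/-- A local smooth extension of `v` is cut off by a bump function equal to 1 at `p`. -/
theorem exists_vectorField_apply_eq (p : M) (v : TangentSpace (𝓡 n) p) :
    ∃ X : VectorFields n M, X p = v := by
  obtain ⟨U, hU, hs⟩ := FiberBundle.exists_contMDiffOn_extend (k := ∞) (𝓡 n)
    (EuclideanSpace ℝ (Fin n)) (V := fun x : M => TangentSpace (𝓡 n) x) v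
  obtain ⟨g, hg, -, hgp, hgs⟩ := exists_bump (n := n) (interior_mem_nhds.2 hU)
  refine ⟨⟨_, ContMDiffOn.smul_section_of_tsupport hg.contMDiffOn isOpen_interior hgs
    (hs.mono interior_subset)⟩, ?_⟩
  change g p • FiberBundle.extend (EuclideanSpace ℝ (Fin n)) v p = v
  rw [hgp, one_smul]
  simp

/-- The product of a smooth function and a smooth vector field. -/
noncomputable def smulVectorField {g : M → ℝ} (hg : ContMDiff (𝓡 n) 𝓘(ℝ) ∞ g) (X : VectorFields n M) :
    VectorFields n M :=
  ⟨g • ⇑X, hg.smul_section X.contMDiff⟩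

end VectorFields

/-! ### The action on 1-form densities and the level sets of the momentum map. -/

section Cotangent

variable {k n : ℕ} {S : Type*} [TopologicalSpace S] [ChartedSpace (EuclideanSpace ℝ (Fin k)) S]
  {M : Type*} [TopologicalSpace M] [ChartedSpace (EuclideanSpace ℝ (Fin n)) M]
  [IsManifold (𝓡 n) ∞ M]

theorem cotangent_ext {a b : Cotangent n M} (h : a.proj = b.proj)
    (hv : ∀ v : EuclideanSpace ℝ (Fin n),
      (show EuclideanSpace ℝ (Fin n) →L[ℝ] ℝ from a.snd) v =
        (show EuclideanSpace ℝ (Fin n) →L[ℝ] ℝ from b.snd) v) : a = b := by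
  obtain ⟨p, α⟩ := a
  obtain ⟨q, β⟩ := b
  obtain rfl : p = q := h
  congr 1
  exact ContinuousLinearMap.ext hv

theorem contMDiff_smul_cotangent {R : S → Cotangent n M} {g : S → ℝ}
    (hR : ContMDiff (𝓡 k) ((𝓡 n).prod 𝓘(ℝ, EuclideanSpace ℝ (Fin n) →L[ℝ] ℝ)) ∞ R)
    (hg : ContMDiff (𝓡 k) 𝓘(ℝ) ∞ g) :
    ContMDiff (𝓡 k) ((𝓡 n).prod 𝓘(ℝ, EuclideanSpace ℝ (Fin n) →L[ℝ] ℝ)) ∞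
      (fun s => (⟨(R s).proj, g s • (R s).snd⟩ : Cotangent n M)) := by
  intro s
  have h := contMDiffAt_totalSpace.1 (hR s)
  refine contMDiffAt_totalSpace.2 ⟨h.1, ?_⟩
  refine ((hg s).smul h.2).congr_of_eventuallyEq ?_
  set e := trivializationAt (EuclideanSpace ℝ (Fin n) →L[ℝ] ℝ)
    (fun x : M => TangentSpace (𝓡 n) x →L[ℝ] Bundle.Trivial M ℝ x) (R s).proj
  have hb : ∀ᶠ t in 𝓝 s, (R t).proj ∈ e.baseSet :=
    h.1.continuousAt.preimage_mem_nhds (e.open_baseSet.mem_nhds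
      (FiberBundle.mem_baseSet_trivializationAt' _))
  filter_upwards [hb] with t ht
  -- The trivialization is linear on fibres, so the fibre coordinate of `g • R` is `g` times that of
  -- `R`.
  exact (e.linear ℝ ht).2 (g t) (R t).snd

theorem pairing_smulVectorField {S : Type*} [T2Space M] (P : S → Cotangent n M) {g : M → ℝ}
    (hg : ContMDiff (𝓡 n) 𝓘(ℝ) ∞ g) (X : VectorFields n M) (s : S) :
    pairing P (smulVectorField hg X) s = g (footpoint P s) * pairing P X s :=
  (P s).snd.map_smul (g (footpoint P s)) (X (P s).proj)

theorem rightAct_refl (μ : VolumeForm k S) (P : S → Cotangent n M) :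
    rightAct μ P (Diffeomorph.refl (𝓡 k) S ∞) = P := by
  funext s
  refine cotangent_ext rfl fun v => ?_
  change |μ.jacobian (Diffeomorph.refl (𝓡 k) S ∞) s| *
    (show EuclideanSpace ℝ (Fin n) →L[ℝ] ℝ from (P s).snd) v = _
  rw [μ.jacobian_refl, abs_one, one_mul]

theorem rightAct_rightAct (μ : VolumeForm k S) (P : S → Cotangent n M)
    (φ ψ : S ≃ₘ^∞⟮𝓡 k, 𝓡 k⟯ S) :
    rightAct μ (rightAct μ P φ) ψ = rightAct μ P (ψ.trans φ) := by
  funext s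
  refine cotangent_ext rfl fun v => ?_
  change |μ.jacobian ψ s| * (|μ.jacobian φ (ψ s)| *
    (show EuclideanSpace ℝ (Fin n) →L[ℝ] ℝ from (P (φ (ψ s))).snd) v) =
    |μ.jacobian (ψ.trans φ) s| *
      (show EuclideanSpace ℝ (Fin n) →L[ℝ] ℝ from (P (φ (ψ s))).snd) v
  rw [μ.jacobian_trans, abs_mul]
  ring

theorem rightAct_mem [IsManifold (𝓡 k) ∞ S] (μ : VolumeForm k S) {P : S → Cotangent n M}
    (hP : P ∈ CotEmbNonvanishing k n S M) (ψ : S ≃ₘ^∞⟮𝓡 k, 𝓡 k⟯ S) :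
    rightAct μ P ψ ∈ CotEmbNonvanishing k n S M :=
  ⟨contMDiff_smul_cotangent (hP.1.comp ψ.contMDiff) (μ.contMDiff_abs_jacobian ψ),
    isSmoothEmbedding_comp_diffeomorph hP.2.1 ψ,
    fun s => smul_ne_zero (abs_ne_zero.2 (μ.jacobian_ne_zero ψ s)) (hP.2.2 (ψ s))⟩

variable [IsManifold (𝓡 k) ∞ S] [CompactSpace S] [T2Space S] [MeasurableSpace S] [BorelSpace S]

theorem momentumLeft_rightAct (μ : VolumeForm k S) (P P' : CotEmbNonvanishing k n S M)
    (ψ : S ≃ₘ^∞⟮𝓡 k, 𝓡 k⟯ S) (h : P'.1 = rightAct μ P.1 ψ) :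
    momentumLeft μ P' = momentumLeft μ P := by
  ext X
  change ∫ s, pairing P'.1 X s ∂μ.measure = ∫ s, pairing P.1 X s ∂μ.measure
  rw [h]
  exact μ.integral_jacobian_mul_comp ψ (continuous_pairing P.2 X)

variable [T2Space M]

/-- A fundamental lemma of the calculus of variations whose test functions live on `M`. Because `S`
carries the topology induced by `Q`, the neighbourhood of `s₀` where `h` keeps its sign contains the
preimage of some neighbourhood `W` of `Q(s₀)`, and `g` is supported in `O ∩ W`. -/
theorem exists_bump_integral_ne_zero (μ : VolumeForm k S) {Q : S → M} (hQ : Topology.IsEmbedding Q)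
    {h : S → ℝ} (hh : Continuous h) {s₀ : S} (h0 : h s₀ ≠ 0) {O : Set M} (hO : O ∈ 𝓝 (Q s₀)) :
    ∃ g : M → ℝ, ContMDiff (𝓡 n) 𝓘(ℝ) ∞ g ∧ (∀ q ∉ O, g q = 0) ∧
      ∫ s, g (Q s) * h s ∂μ.measure ≠ 0 := by
  have hU : {s | 0 < h s₀ * h s} ∈ 𝓝 s₀ :=
    (isOpen_lt continuous_const (continuous_const.mul hh)).mem_nhds (mul_self_pos.2 h0)
  obtain ⟨W, hW, hWU⟩ := (hQ.isInducing.nhds_eq_comap s₀ ▸ Filter.mem_comap).1 hU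
  obtain ⟨g, hg, hg0, hg1, hgs⟩ := exists_bump (n := n) (Filter.inter_mem hO hW)
  have hg' : ∀ q ∉ O ∩ W, g q = 0 := fun q hq =>
    image_eq_zero_of_notMem_tsupport fun hq' => hq (hgs hq')
  refine ⟨g, hg, fun q hq => hg' q fun hq' => hq hq'.1, fun hI => ?_⟩
  -- The constant factor `h s₀` makes the integrand nonnegative whatever the sign of `h` near `s₀`.
  have hcont : Continuous fun s => h s₀ * (g (Q s) * h s) :=
    continuous_const.mul ((hg.continuous.comp hQ.continuous).mul hh)
  have hpos := μ.integral_pos hcont (fun s => ?_) (s := s₀) ?_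
  · rw [integral_const_mul, hI, mul_zero] at hpos
    exact lt_irrefl _ hpos
  · by_cases hs : Q s ∈ O ∩ W
    · have := hWU hs.2
      rw [mul_left_comm]
      exact mul_nonneg (hg0 _) (le_of_lt this)
    · rw [hg' _ hs, zero_mul, mul_zero]
  · rw [hg1, one_mul]
    exact mul_self_pos.2 h0

theorem range_footpoint_subset (μ : VolumeForm k S) {P P' : CotEmbNonvanishing k n S M}
    (h : momentumLeft μ P = momentumLeft μ P') :
    range (footpoint P.1) ⊆ range (footpoint P'.1) := by
  rintro _ ⟨s₀, rfl⟩
  by_contra hs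
  obtain ⟨v, hv⟩ := DFunLike.ne_iff.1 (P.2.2.2 s₀)
  obtain ⟨X, hX⟩ := exists_vectorField_apply_eq (footpoint P.1 s₀) v
  have h0 : pairing P.1 X s₀ ≠ 0 := by
    change (P.1 s₀).snd (X (footpoint P.1 s₀)) ≠ 0
    rw [hX]
    exact hv
  -- Compactness of `S` leaves room around `Q(s₀)` for a bump that vanishes on all of `Q'(S)`.
  have hclosed : IsClosed (range (footpoint P'.1)) :=
    (isCompact_range P'.2.2.1.contMDiff.continuous).isClosed
  obtain ⟨g, hg, hgO, hI⟩ := exists_bump_integral_ne_zero (n := n) μ P.2.2.1.isEmbedding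
    (continuous_pairing P.2 X) h0 (hclosed.isOpen_compl.mem_nhds hs)
  have h1 : ∫ s, pairing P.1 (smulVectorField hg X) s ∂μ.measure =
      ∫ s, pairing P'.1 (smulVectorField hg X) s ∂μ.measure :=
    LinearMap.congr_fun h (smulVectorField hg X)
  simp only [pairing_smulVectorField] at h1
  refine hI (h1.trans ?_)
  have h2 : ∀ s, g (footpoint P'.1 s) = 0 := fun s => hgO _ fun hs' => hs' (mem_range_self s)
  simp [h2]

theorem eq_of_momentumLeft_eq (μ : VolumeForm k S) {P P' : CotEmbNonvanishing k n S M}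
    (h : momentumLeft μ P = momentumLeft μ P') (hf : footpoint P.1 = footpoint P'.1) :
    P.1 = P'.1 := by
  funext s₀
  have hf0 : (P.1 s₀).proj = (P'.1 s₀).proj := congrFun hf s₀
  refine cotangent_ext hf0 fun v => ?_
  by_contra hne
  obtain ⟨X, hX⟩ := exists_vectorField_apply_eq (P.1 s₀).proj v
  have hX' : (show EuclideanSpace ℝ (Fin n) from X (P'.1 s₀).proj) = v := by
    rw [← hf0]
    exact hX
  -- With a common footpoint map, `g` factors out of both pairings, so the difference plays the role
  -- of `h` in the bump lemma.
  have h0 : pairing P.1 X s₀ - pairing P'.1 X s₀ ≠ 0 := by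
    refine sub_ne_zero.2 ?_
    change (show EuclideanSpace ℝ (Fin n) →L[ℝ] ℝ from (P.1 s₀).snd)
      (show EuclideanSpace ℝ (Fin n) from X (P.1 s₀).proj) ≠
      (show EuclideanSpace ℝ (Fin n) →L[ℝ] ℝ from (P'.1 s₀).snd)
      (show EuclideanSpace ℝ (Fin n) from X (P'.1 s₀).proj)
    rw [hX', hX]
    exact hne
  obtain ⟨g, hg, -, hI⟩ := exists_bump_integral_ne_zero (n := n) μ P.2.2.1.isEmbedding
    ((continuous_pairing P.2 X).sub (continuous_pairing P'.2 X)) h0 Filter.univ_mem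
  have h1 : ∫ s, pairing P.1 (smulVectorField hg X) s ∂μ.measure =
      ∫ s, pairing P'.1 (smulVectorField hg X) s ∂μ.measure :=
    LinearMap.congr_fun h (smulVectorField hg X)
  refine hI ?_
  rw [← sub_eq_zero, ← integral_sub (integrable_pairing μ P.2 _) (integrable_pairing μ P'.2 _)]
    at h1
  rw [← h1]
  refine integral_congr_ae (Filter.Eventually.of_forall fun s => ?_)
  simp only [pairing_smulVectorField, ← hf, Pi.sub_apply]
  ring

theorem exists_rightAct_eq (μ : VolumeForm k S) {P P' : CotEmbNonvanishing k n S M}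
    (h : momentumLeft μ P = momentumLeft μ P') :
    range (footpoint P.1) = range (footpoint P'.1) ∧
      ∃ ψ : S ≃ₘ^∞⟮𝓡 k, 𝓡 k⟯ S,
        footpoint P'.1 = footpoint P.1 ∘ ψ ∧ P'.1 = rightAct μ P.1 ψ := by
  have hr : range (footpoint P.1) = range (footpoint P'.1) :=
    (range_footpoint_subset μ h).antisymm (range_footpoint_subset μ h.symm)
  obtain ⟨ψ, hψ⟩ := exists_diffeomorph_comp_eq P.2.2.1 P'.2.2.1 hr
  -- Moving `P` by `ψ` keeps its momentum and reduces the claim to equal footpoints.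
  let R : CotEmbNonvanishing k n S M := ⟨rightAct μ P.1 ψ, rightAct_mem μ P.2 ψ⟩
  have hR : momentumLeft μ P' = momentumLeft μ R :=
    h.symm.trans (momentumLeft_rightAct μ P R ψ rfl).symm
  exact ⟨hr, ψ, hψ, eq_of_momentumLeft_eq μ hR hψ⟩

end Cotangent

end EPDiff

theorem proposition5p2 {k n : ℕ}
    {S : Type*} [TopologicalSpace S] [ChartedSpace (EuclideanSpace ℝ (Fin k)) S]
    [IsManifold (𝓡 k) ∞ S] [CompactSpace S] [T2Space S] [MeasurableSpace S] [BorelSpace S]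
    {M : Type*} [TopologicalSpace M] [ChartedSpace (EuclideanSpace ℝ (Fin n)) M]
    [IsManifold (𝓡 n) ∞ M] [T2Space M] [SecondCountableTopology M]
    (μ : EPDiff.VolumeForm k S) :
    -- `(P, ψ) ↦ P·ψ` is a right action of `Diff(S)` on `T^*Emb(S,M)^×`
    (∀ P ∈ EPDiff.CotEmbNonvanishing k n S M,
      EPDiff.rightAct μ P (Diffeomorph.refl (𝓡 k) S ∞) = P ∧
      (∀ ψ : S ≃ₘ^∞⟮𝓡 k, 𝓡 k⟯ S, EPDiff.rightAct μ P ψ ∈ EPDiff.CotEmbNonvanishing k n S M) ∧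
      ∀ φ ψ : S ≃ₘ^∞⟮𝓡 k, 𝓡 k⟯ S,
        EPDiff.rightAct μ (EPDiff.rightAct μ P φ) ψ = EPDiff.rightAct μ P (ψ.trans φ)) ∧
    -- which preserves the level sets of `J_L`
    (∀ P P' : EPDiff.CotEmbNonvanishing k n S M, ∀ ψ : S ≃ₘ^∞⟮𝓡 k, 𝓡 k⟯ S,
      P'.1 = EPDiff.rightAct μ P.1 ψ →
        EPDiff.momentumLeft μ P' = EPDiff.momentumLeft μ P) ∧
    -- and is transitive on each of them
    (∀ P P' : EPDiff.CotEmbNonvanishing k n S M,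
      EPDiff.momentumLeft μ P = EPDiff.momentumLeft μ P' →
        range (EPDiff.footpoint P.1) = range (EPDiff.footpoint P'.1) ∧
        ∃ ψ : S ≃ₘ^∞⟮𝓡 k, 𝓡 k⟯ S,
          EPDiff.footpoint P'.1 = EPDiff.footpoint P.1 ∘ ψ ∧
          P'.1 = EPDiff.rightAct μ P.1 ψ) := by
  exact ⟨fun P hP => ⟨EPDiff.rightAct_refl μ P, EPDiff.rightAct_mem μ hP,
      EPDiff.rightAct_rightAct μ P⟩,
    EPDiff.momentumLeft_rightAct μ, fun _ _ h => EPDiff.exists_rightAct_eq μ h⟩
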